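/- **Conventions.** A left act of a monoid $S$ is a set $A$ with an action $S\times A\to A$ such that $1a=a$ and $s(ta)=(st)a$; right acts are defined dually. The free left $S$-act on a set $Y$ is $Y\times S$ with $t(y,s)=(y,ts)$. An $S$-act is *finitely presented* if it is isomorphic to $F/\rho$, where $F$ is the free act on a finite set and $\rho$ is a finitely generated act congruence on $F$. A monoid $S$ is *left (right) coherent* if every finitely generated subact of every finitely presented left (right) $S$-act is finitely presented. Let $E$ be a semilattice of idempotents of a monoid $S$ (commuting idempotents, closed under products). Write $a\,\widetilde{\mathcal R}_E\,b$ if $a$ and $b$ have the same left identities from $E$. Then $S$ is *left $E$-Ehresmann* if $\widetilde{\mathcal R}_E$ is a left congruence and every $\widetilde{\mathcal R}_E$-class contains exactly one element of $E$; the element of $E$ in the class of $a$ is denoted $a^+$. Dually, with right identities and $\widetilde{\mathcal L}_E$, one defines *right $E$-Ehresmann* monoids and $a^*$. A *left Ehresmann monoid* is a monoid that is left $E$-Ehresmann for some $E$, regarded as a unary monoid with the operation $a\mapsto a^+$; an *Ehresmann monoid* is a monoid that is both left and right $E$-Ehresmann for the same $E$, regarded as a bi-unary monoid with the operations $a\mapsto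 a^+$ and $a\mapsto a^*$. Each of these classes is a variety. Let $\mathrm{FLAd}(X)$ be the free left Ehresmann monoid on the set $X$ and $\mathrm{FAd}(X)$ the free Ehresmann monoid on $X$, that is, the free algebras on $X$ in these varieties of unary and bi-unary monoids, respectively. **Theorem.** Let $X$ be a set with $|X|>1$. Then, regarded as monoids, 1. $\mathrm{FAd}(X)$ is not left coherent and is not right coherent; 2. $\mathrm{FLAd}(X)$ is not left coherent. -/

import Mathlib

universe u v

/-! ### Left acts, finite presentability, coherence

A left `S`-act is a `MulAction S A`; a right `S`-act is a left act of the opposite monoid,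
`MulAction Sᵐᵒᵖ A`, as usual in Mathlib. -/

/-- The free left `S`-act on a set `X`: the set `X × S` with `t • (x, s) = (x, t * s)`. -/
abbrev FreeAct (S : Type u) (X : Type v) : Type (max u v) := (_ : X) × S

/-- `ρ` is the smallest act congruence containing `Y`. -/
def SMulCon.IsGeneratedBy {S : Type u} {A : Type v} [SMul S A] (ρ : SMulCon S A)
    (Y : Set (A × A)) : Prop :=
  (∀ p ∈ Y, ρ.toSetoid p.1 p.2) ∧
    ∀ σ : SMulCon S A, (∀ p ∈ Y, σ.toSetoid p.1 p.2) →
      ∀ a b, ρ.toSetoid a b → σ.toSetoid a b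

/-- An act congruence is finitely generated if it is generated by a finite set of pairs. -/
def SMulCon.IsFinitelyGenerated {S : Type u} {A : Type v} [SMul S A] (ρ : SMulCon S A) : Prop :=
  ∃ Y : Set (A × A), Y.Finite ∧ ρ.IsGeneratedBy Y

/-- A left `S`-act is finitely presented if it is isomorphic to `F / ρ`, with `F` the free act on
a finite set and `ρ` a finitely generated congruence on `F`. -/
def IsFinitelyPresentedAct (S : Type u) [Monoid S] (A : Type v) [MulAction S A] : Prop :=
  ∃ (n : ℕ) (ρ : SMulCon S (FreeAct S (Fin n))), ρ.IsFinitelyGenerated ∧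
    ∃ f : ρ.Quotient →[S] A, Function.Bijective f

/-- A subact `B` is finitely generated if `B = S Y` for a finite set `Y`. -/
def SubMulAction.IsFinitelyGenerated {S : Type u} [Monoid S] {A : Type v} [MulAction S A]
    (B : SubMulAction S A) : Prop :=
  ∃ Y : Set A, Y.Finite ∧ (B : Set A) = {a | ∃ y ∈ Y, ∃ s : S, a = s • y}

/-- `S` is left coherent if every finitely generated subact of every finitely presented left
`S`-act is finitely presented. (Up to isomorphism, all finitely presented `S`-acts live in the
universe of `S`.) -/
def IsLeftCoherent (S : Type u) [Monoid S] : Prop :=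
  ∀ (A : Type u) [MulAction S A], IsFinitelyPresentedAct S A →
    ∀ B : SubMulAction S A, B.IsFinitelyGenerated → IsFinitelyPresentedAct S B

/-- `S` is right coherent if every finitely generated subact of every finitely presented right
`S`-act is finitely presented; right `S`-acts are the left acts of `Sᵐᵒᵖ`. -/
def IsRightCoherent (S : Type u) [Monoid S] : Prop :=
  IsLeftCoherent Sᵐᵒᵖ

/-! ### Ehresmann monoids -/

section Ehresmann

variable {S : Type u} [Monoid S]

/-- `a` and `b` have the same left identities from `E`. -/
def TildeR (E : Set S) (a b : S) : Prop := ∀ e ∈ E, e * a = a ↔ e * b = b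

/-- `a` and `b` have the same right identities from `E`. -/
def TildeL (E : Set S) (a b : S) : Prop := ∀ e ∈ E, a * e = a ↔ b * e = b

/-- `E` is a subsemilattice of the monoid: it consists of commuting idempotents and is closed
under products. -/
structure IsSemilatticeIn (E : Set S) : Prop where
  idem : ∀ e ∈ E, e * e = e
  comm : ∀ e ∈ E, ∀ f ∈ E, e * f = f * e
  mul_mem : ∀ e ∈ E, ∀ f ∈ E, e * f ∈ E

/-- `S` is left `E`-Ehresmann. -/
structure IsLeftEhresmann (E : Set S) : Prop extends IsSemilatticeIn E where
  existsUnique : ∀ a, ∃! e, e ∈ E ∧ TildeR E a e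
  leftCongruence : ∀ a b c, TildeR E a b → TildeR E (c * a) (c * b)

/-- `S` is right `E`-Ehresmann. -/
structure IsRightEhresmann (E : Set S) : Prop extends IsSemilatticeIn E where
  existsUnique : ∀ a, ∃! e, e ∈ E ∧ TildeL E a e
  rightCongruence : ∀ a b c, TildeL E a b → TildeL E (a * c) (b * c)

/-- The unary-monoid identities of left Ehresmann monoids. -/
structure LeftEhresmannIdentities (p : S → S) : Prop where
  plus_mul_self : ∀ a, p a * a = a
  plus_comm : ∀ a b, p a * p b = p b * p a
  plus_plus : ∀ a b, p (p a * p b) = p a * p b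
  plus_mul : ∀ a b, p (a * b) = p (a * p b)

/-- The unary-monoid identities of right Ehresmann monoids. -/
structure RightEhresmannIdentities (q : S → S) : Prop where
  self_mul_star : ∀ a, a * q a = a
  star_comm : ∀ a b, q a * q b = q b * q a
  star_star : ∀ a b, q (q a * q b) = q a * q b
  star_mul : ∀ a b, q (a * b) = q (q a * b)

theorem leftEhresmann_iff_identities (p : S → S) :
    (IsLeftEhresmann (Set.range p) ∧ ∀ a, TildeR (Set.range p) a (p a)) ↔
      LeftEhresmannIdentities p := by
  constructor
  · rintro ⟨h, ht⟩
    have huniq : ∀ a e, e ∈ Set.range p → TildeR (Set.range p) a e → p a = e := fun a e he hae =>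
      (h.existsUnique a).unique ⟨⟨a, rfl⟩, ht a⟩ ⟨he, hae⟩
    refine ⟨fun a => (ht a (p a) ⟨a, rfl⟩).2 (h.idem _ ⟨a, rfl⟩),
      fun a b => h.comm _ ⟨a, rfl⟩ _ ⟨b, rfl⟩,
      fun a b => huniq _ _ (h.mul_mem _ ⟨a, rfl⟩ _ ⟨b, rfl⟩) (fun _ _ => Iff.rfl), fun a b => ?_⟩
    refine huniq _ _ ⟨_, rfl⟩ fun e he => ?_
    exact (h.leftCongruence _ _ a (ht b) e he).trans (ht (a * p b) e he)
  · intro h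
    have hpp : ∀ a, p (p a) = p a := fun a => by
      have := h.plus_mul 1 a
      simpa using this.symm
    have hid : ∀ a, p a * p a = p a := fun a => by
      rw [← h.plus_plus, ← h.plus_mul, h.plus_mul_self]
    have ht : ∀ a, TildeR (Set.range p) a (p a) := by
      rintro a _ ⟨c, rfl⟩
      constructor
      · intro hc
        calc p c * p a = p (p c * p a) := (h.plus_plus c a).symm
          _ = p (p c * a) := (h.plus_mul _ _).symm
          _ = p a := by rw [hc]
      · intro hc
        calc p c * a = p c * (p a * a) := by rw [h.plus_mul_self]
          _ = p a * a := by rw [← mul_assoc, hc]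
          _ = a := h.plus_mul_self a
    have huniq : ∀ e ∈ Set.range p, ∀ f ∈ Set.range p, TildeR (Set.range p) e f → e = f := by
      rintro _ ⟨a, rfl⟩ _ ⟨b, rfl⟩ hef
      have h1 := (hef (p a) ⟨a, rfl⟩).1 (hid a)
      have h2 := (hef (p b) ⟨b, rfl⟩).2 (hid b)
      rw [← h2, ← h.plus_comm, h1]
    refine ⟨⟨⟨?_, ?_, ?_⟩, fun a => ⟨p a, ⟨⟨a, rfl⟩, ht a⟩, ?_⟩, ?_⟩, ht⟩
    · rintro _ ⟨a, rfl⟩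
      exact hid a
    · rintro _ ⟨a, rfl⟩ _ ⟨b, rfl⟩
      exact h.plus_comm a b
    · rintro _ ⟨a, rfl⟩ _ ⟨b, rfl⟩
      exact ⟨_, h.plus_plus a b⟩
    · rintro e ⟨he, hae⟩
      exact huniq _ he _ ⟨a, rfl⟩ fun f hf => (hae f hf).symm.trans (ht a f hf)
    · intro a b c hab
      have hpab : p a = p b := huniq _ ⟨a, rfl⟩ _ ⟨b, rfl⟩ fun f hf =>
        (ht a f hf).symm.trans ((hab f hf).trans (ht b f hf))
      intro f hf
      rw [ht (c * a) f hf, ht (c * b) f hf, h.plus_mul c a, h.plus_mul c b, hpab]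

theorem rightEhresmann_iff_identities (q : S → S) :
    (IsRightEhresmann (Set.range q) ∧ ∀ a, TildeL (Set.range q) a (q a)) ↔
      RightEhresmannIdentities q := by
  constructor
  · rintro ⟨h, ht⟩
    have huniq : ∀ a e, e ∈ Set.range q → TildeL (Set.range q) a e → q a = e := fun a e he hae =>
      (h.existsUnique a).unique ⟨⟨a, rfl⟩, ht a⟩ ⟨he, hae⟩
    refine ⟨fun a => (ht a (q a) ⟨a, rfl⟩).2 (h.idem _ ⟨a, rfl⟩),
      fun a b => h.comm _ ⟨a, rfl⟩ _ ⟨b, rfl⟩,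
      fun a b => huniq _ _ (h.mul_mem _ ⟨a, rfl⟩ _ ⟨b, rfl⟩) (fun _ _ => Iff.rfl), fun a b => ?_⟩
    refine huniq _ _ ⟨_, rfl⟩ fun e he => ?_
    exact (h.rightCongruence _ _ b (ht a) e he).trans (ht (q a * b) e he)
  · intro h
    have hqq : ∀ a, q (q a) = q a := fun a => by
      have := h.star_mul a 1
      simpa using this.symm
    have hid : ∀ a, q a * q a = q a := fun a => by
      rw [← h.star_star, ← h.star_mul, h.self_mul_star]
    have ht : ∀ a, TildeL (Set.range q) a (q a) := by
      rintro a _ ⟨c, rfl⟩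
      constructor
      · intro hc
        calc q a * q c = q (q a * q c) := (h.star_star a c).symm
          _ = q (a * q c) := (h.star_mul _ _).symm
          _ = q a := by rw [hc]
      · intro hc
        calc a * q c = (a * q a) * q c := by rw [h.self_mul_star]
          _ = a * q a := by rw [mul_assoc, hc]
          _ = a := h.self_mul_star a
    have huniq : ∀ e ∈ Set.range q, ∀ f ∈ Set.range q, TildeL (Set.range q) e f → e = f := by
      rintro _ ⟨a, rfl⟩ _ ⟨b, rfl⟩ hef
      have h1 := (hef (q a) ⟨a, rfl⟩).1 (hid a)
      have h2 := (hef (q b) ⟨b, rfl⟩).2 (hid b)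
      rw [← h2, ← h.star_comm, h1]
    refine ⟨⟨⟨?_, ?_, ?_⟩, fun a => ⟨q a, ⟨⟨a, rfl⟩, ht a⟩, ?_⟩, ?_⟩, ht⟩
    · rintro _ ⟨a, rfl⟩
      exact hid a
    · rintro _ ⟨a, rfl⟩ _ ⟨b, rfl⟩
      exact h.star_comm a b
    · rintro _ ⟨a, rfl⟩ _ ⟨b, rfl⟩
      exact ⟨_, h.star_star a b⟩
    · rintro e ⟨he, hae⟩
      exact huniq _ he _ ⟨a, rfl⟩ fun f hf => (hae f hf).symm.trans (ht a f hf)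
    · intro a b c hab
      have hqab : q a = q b := huniq _ ⟨a, rfl⟩ _ ⟨b, rfl⟩ fun f hf =>
        (ht a f hf).symm.trans ((hab f hf).trans (ht b f hf))
      intro f hf
      rw [ht (a * c) f hf, ht (b * c) f hf, h.star_mul a c, h.star_mul b c, hqab]

end Ehresmann

/-- A left Ehresmann monoid as a unary monoid: `S` is left `E`-Ehresmann for a semilattice of
idempotents `E`, and `plus a` is the element of `E` with the same left identities from `E` as `a`.
Then `E` is the set of all elements `plus a`. -/
class LeftEhresmannMonoid (S : Type u) extends Monoid S where
  plus : S → S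
  isLeftEhresmann : IsLeftEhresmann (Set.range plus)
  tildeR_plus : ∀ a, TildeR (Set.range plus) a (plus a)

/-- A (two-sided) Ehresmann monoid as a bi-unary monoid: `S` is left and right `E`-Ehresmann for
the same semilattice `E`, with `E` the set of all `plus a` and also the set of all `star a`. -/
class EhresmannMonoid (S : Type u) extends LeftEhresmannMonoid S where
  star : S → S
  range_star : Set.range star = Set.range plus
  isRightEhresmann : IsRightEhresmann (Set.range star)
  tildeL_star : ∀ a, TildeL (Set.range star) a (star a)

/-! ### The free left Ehresmann monoid -/

/-- Terms over `X` in the signature of unary monoids. -/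
inductive LTerm (X : Type u) : Type u
  | var : X → LTerm X
  | one : LTerm X
  | mul : LTerm X → LTerm X → LTerm X
  | plus : LTerm X → LTerm X

/-- The fully invariant congruence on terms given by the identities of left Ehresmann monoids. -/
inductive LTerm.Rel {X : Type u} : LTerm X → LTerm X → Prop
  | refl (a : LTerm X) : Rel a a
  | symm {a b : LTerm X} : Rel a b → Rel b a
  | trans {a b c : LTerm X} : Rel a b → Rel b c → Rel a c
  | mul_congr {a b c d : LTerm X} : Rel a b → Rel c d → Rel (a.mul c) (b.mul d)
  | plus_congr {a b : LTerm X} : Rel a b → Rel a.plus b.plus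
  | mul_assoc (a b c : LTerm X) : Rel ((a.mul b).mul c) (a.mul (b.mul c))
  | one_mul (a : LTerm X) : Rel (one.mul a) a
  | mul_one (a : LTerm X) : Rel (a.mul one) a
  | plus_mul_self (a : LTerm X) : Rel (a.plus.mul a) a
  | plus_comm (a b : LTerm X) : Rel (a.plus.mul b.plus) (b.plus.mul a.plus)
  | plus_plus (a b : LTerm X) : Rel (a.plus.mul b.plus).plus (a.plus.mul b.plus)
  | plus_mul (a b : LTerm X) : Rel (a.mul b).plus (a.mul b.plus).plus

/-- The setoid of the congruence on terms. -/
instance LTerm.setoid (X : Type u) : Setoid (LTerm X) where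
  r := LTerm.Rel
  iseqv := ⟨.refl, .symm, .trans⟩

/-- The free left Ehresmann monoid on `X`, that is, the free algebra on `X` in the variety of left
Ehresmann monoids (as unary monoids). -/
def FLAd (X : Type u) : Type u := Quotient (LTerm.setoid X)

namespace FLAd

variable {X : Type u}

/-- The canonical map from the generating set. -/
def of (x : X) : FLAd X := Quotient.mk _ (.var x)

instance : Monoid (FLAd X) where
  one := Quotient.mk _ .one
  mul := Quotient.map₂ .mul fun _ _ h _ _ h' => .mul_congr h h'
  mul_assoc := by
    rintro ⟨a⟩ ⟨b⟩ ⟨c⟩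
    exact Quotient.sound (.mul_assoc a b c)
  one_mul := by
    rintro ⟨a⟩
    exact Quotient.sound (.one_mul a)
  mul_one := by
    rintro ⟨a⟩
    exact Quotient.sound (.mul_one a)

/-- The operation `a ↦ a⁺`. -/
def plus : FLAd X → FLAd X := Quotient.map .plus fun _ _ h => .plus_congr h

theorem identities : LeftEhresmannIdentities (plus : FLAd X → FLAd X) where
  plus_mul_self := by
    rintro ⟨a⟩
    exact Quotient.sound (.plus_mul_self a)
  plus_comm := by
    rintro ⟨a⟩ ⟨b⟩
    exact Quotient.sound (.plus_comm a b)
  plus_plus := by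
    rintro ⟨a⟩ ⟨b⟩
    exact Quotient.sound (.plus_plus a b)
  plus_mul := by
    rintro ⟨a⟩ ⟨b⟩
    exact Quotient.sound (.plus_mul a b)

instance : LeftEhresmannMonoid (FLAd X) where
  plus := plus
  isLeftEhresmann := ((leftEhresmann_iff_identities _).2 identities).1
  tildeR_plus := ((leftEhresmann_iff_identities _).2 identities).2

/-- The value of a term under an assignment of the variables. -/
def eval {S : Type v} [LeftEhresmannMonoid S] (g : X → S) : LTerm X → S
  | .var x => g x
  | .one => 1
  | .mul a b => eval g a * eval g b
  | .plus a => LeftEhresmannMonoid.plus (eval g a)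

theorem eval_eq {S : Type v} [LeftEhresmannMonoid S] (g : X → S) {a b : LTerm X}
    (h : LTerm.Rel a b) : eval g a = eval g b := by
  have hS := (leftEhresmann_iff_identities (LeftEhresmannMonoid.plus : S → S)).1
    ⟨LeftEhresmannMonoid.isLeftEhresmann, LeftEhresmannMonoid.tildeR_plus⟩
  induction h with
  | refl => rfl
  | symm _ ih => exact ih.symm
  | trans _ _ ih ih' => exact ih.trans ih'
  | mul_congr _ _ ih ih' => simp only [eval, ih, ih']
  | plus_congr _ ih => simp only [eval, ih]
  | mul_assoc => exact _root_.mul_assoc _ _ _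
  | one_mul => exact _root_.one_mul _
  | mul_one => exact _root_.mul_one _
  | plus_mul_self => exact hS.plus_mul_self _
  | plus_comm => exact hS.plus_comm _ _
  | plus_plus => exact hS.plus_plus _ _
  | plus_mul => exact hS.plus_mul _ _

/-- The universal property: `FLAd X` is the free left Ehresmann monoid on `X`. -/
theorem existsUnique_lift {S : Type v} [LeftEhresmannMonoid S] (g : X → S) :
    ∃! f : FLAd X →* S,
      (∀ a, f (LeftEhresmannMonoid.plus a) = LeftEhresmannMonoid.plus (f a)) ∧
      ∀ x, f (of x) = g x := by
  refine ⟨{ toFun := Quotient.lift (eval g) fun _ _ h => eval_eq g h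
            map_one' := rfl
            map_mul' := ?_ }, ⟨?_, fun _ => rfl⟩, ?_⟩
  · rintro ⟨a⟩ ⟨b⟩
    rfl
  · rintro ⟨a⟩
    rfl
  · rintro f ⟨hp, hx⟩
    ext t
    obtain ⟨t, rfl⟩ := Quotient.exists_rep t
    induction t with
    | var x => exact hx x
    | one => exact f.map_one
    | mul a b iha ihb => exact (f.map_mul _ _).trans (congrArg₂ (· * ·) iha ihb)
    | plus a ih => exact (hp _).trans (congrArg LeftEhresmannMonoid.plus ih)

end FLAd

/-! ### The free Ehresmann monoid -/

/-- Terms over `X` in the signature of bi-unary monoids. -/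
inductive ETerm (X : Type u) : Type u
  | var : X → ETerm X
  | one : ETerm X
  | mul : ETerm X → ETerm X → ETerm X
  | plus : ETerm X → ETerm X
  | star : ETerm X → ETerm X

/-- The fully invariant congruence on terms given by the identities of Ehresmann monoids. -/
inductive ETerm.Rel {X : Type u} : ETerm X → ETerm X → Prop
  | refl (a : ETerm X) : Rel a a
  | symm {a b : ETerm X} : Rel a b → Rel b a
  | trans {a b c : ETerm X} : Rel a b → Rel b c → Rel a c
  | mul_congr {a b c d : ETerm X} : Rel a b → Rel c d → Rel (a.mul c) (b.mul d)
  | plus_congr {a b : ETerm X} : Rel a b → Rel a.plus b.plus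
  | star_congr {a b : ETerm X} : Rel a b → Rel a.star b.star
  | mul_assoc (a b c : ETerm X) : Rel ((a.mul b).mul c) (a.mul (b.mul c))
  | one_mul (a : ETerm X) : Rel (one.mul a) a
  | mul_one (a : ETerm X) : Rel (a.mul one) a
  | plus_mul_self (a : ETerm X) : Rel (a.plus.mul a) a
  | plus_comm (a b : ETerm X) : Rel (a.plus.mul b.plus) (b.plus.mul a.plus)
  | plus_plus (a b : ETerm X) : Rel (a.plus.mul b.plus).plus (a.plus.mul b.plus)
  | plus_mul (a b : ETerm X) : Rel (a.mul b).plus (a.mul b.plus).plus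
  | self_mul_star (a : ETerm X) : Rel (a.mul a.star) a
  | star_comm (a b : ETerm X) : Rel (a.star.mul b.star) (b.star.mul a.star)
  | star_star (a b : ETerm X) : Rel (a.star.mul b.star).star (a.star.mul b.star)
  | star_mul (a b : ETerm X) : Rel (a.mul b).star (a.star.mul b).star
  | star_plus (a : ETerm X) : Rel a.plus.star a.plus
  | plus_star (a : ETerm X) : Rel a.star.plus a.star

/-- The setoid of the congruence on terms. -/
instance ETerm.setoid (X : Type u) : Setoid (ETerm X) where
  r := ETerm.Rel
  iseqv := ⟨.refl, .symm, .trans⟩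

/-- The free Ehresmann monoid on `X`, that is, the free algebra on `X` in the variety of Ehresmann
monoids (as bi-unary monoids). -/
def FAd (X : Type u) : Type u := Quotient (ETerm.setoid X)

namespace FAd

variable {X : Type u}

/-- The canonical map from the generating set. -/
def of (x : X) : FAd X := Quotient.mk _ (.var x)

instance : Monoid (FAd X) where
  one := Quotient.mk _ .one
  mul := Quotient.map₂ .mul fun _ _ h _ _ h' => .mul_congr h h'
  mul_assoc := by
    rintro ⟨a⟩ ⟨b⟩ ⟨c⟩
    exact Quotient.sound (.mul_assoc a b c)
  one_mul := by
    rintro ⟨a⟩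
    exact Quotient.sound (.one_mul a)
  mul_one := by
    rintro ⟨a⟩
    exact Quotient.sound (.mul_one a)

/-- The operation `a ↦ a⁺`. -/
def plus : FAd X → FAd X := Quotient.map .plus fun _ _ h => .plus_congr h

/-- The operation `a ↦ a*`. -/
def star : FAd X → FAd X := Quotient.map .star fun _ _ h => .star_congr h

theorem plus_identities : LeftEhresmannIdentities (plus : FAd X → FAd X) where
  plus_mul_self := by
    rintro ⟨a⟩
    exact Quotient.sound (.plus_mul_self a)
  plus_comm := by
    rintro ⟨a⟩ ⟨b⟩
    exact Quotient.sound (.plus_comm a b)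
  plus_plus := by
    rintro ⟨a⟩ ⟨b⟩
    exact Quotient.sound (.plus_plus a b)
  plus_mul := by
    rintro ⟨a⟩ ⟨b⟩
    exact Quotient.sound (.plus_mul a b)

theorem star_identities : RightEhresmannIdentities (star : FAd X → FAd X) where
  self_mul_star := by
    rintro ⟨a⟩
    exact Quotient.sound (.self_mul_star a)
  star_comm := by
    rintro ⟨a⟩ ⟨b⟩
    exact Quotient.sound (.star_comm a b)
  star_star := by
    rintro ⟨a⟩ ⟨b⟩
    exact Quotient.sound (.star_star a b)
  star_mul := by
    rintro ⟨a⟩ ⟨b⟩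
    exact Quotient.sound (.star_mul a b)

instance : EhresmannMonoid (FAd X) where
  plus := plus
  isLeftEhresmann := ((leftEhresmann_iff_identities _).2 plus_identities).1
  tildeR_plus := ((leftEhresmann_iff_identities _).2 plus_identities).2
  star := star
  range_star := by
    apply Set.Subset.antisymm
    · rintro _ ⟨⟨a⟩, rfl⟩
      exact ⟨star (Quotient.mk _ a), Quotient.sound (ETerm.Rel.plus_star a)⟩
    · rintro _ ⟨⟨a⟩, rfl⟩
      exact ⟨plus (Quotient.mk _ a), Quotient.sound (ETerm.Rel.star_plus a)⟩
  isRightEhresmann := ((rightEhresmann_iff_identities _).2 star_identities).1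
  tildeL_star := ((rightEhresmann_iff_identities _).2 star_identities).2

/-- The value of a term under an assignment of the variables. -/
def eval {S : Type v} [EhresmannMonoid S] (g : X → S) : ETerm X → S
  | .var x => g x
  | .one => 1
  | .mul a b => eval g a * eval g b
  | .plus a => LeftEhresmannMonoid.plus (eval g a)
  | .star a => EhresmannMonoid.star (eval g a)

theorem eval_eq {S : Type v} [EhresmannMonoid S] (g : X → S) {a b : ETerm X}
    (h : ETerm.Rel a b) : eval g a = eval g b := by
  have hp := (leftEhresmann_iff_identities (LeftEhresmannMonoid.plus : S → S)).1
    ⟨LeftEhresmannMonoid.isLeftEhresmann, LeftEhresmannMonoid.tildeR_plus⟩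
  have hq := (rightEhresmann_iff_identities (EhresmannMonoid.star : S → S)).1
    ⟨EhresmannMonoid.isRightEhresmann, EhresmannMonoid.tildeL_star⟩
  have hr := EhresmannMonoid.range_star (S := S)
  induction h with
  | refl => rfl
  | symm _ ih => exact ih.symm
  | trans _ _ ih ih' => exact ih.trans ih'
  | mul_congr _ _ ih ih' => simp only [eval, ih, ih']
  | plus_congr _ ih => simp only [eval, ih]
  | star_congr _ ih => simp only [eval, ih]
  | mul_assoc => exact _root_.mul_assoc _ _ _
  | one_mul => exact _root_.one_mul _
  | mul_one => exact _root_.mul_one _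
  | plus_mul_self => exact hp.plus_mul_self _
  | plus_comm => exact hp.plus_comm _ _
  | plus_plus => exact hp.plus_plus _ _
  | plus_mul => exact hp.plus_mul _ _
  | self_mul_star => exact hq.self_mul_star _
  | star_comm => exact hq.star_comm _ _
  | star_star => exact hq.star_star _ _
  | star_mul => exact hq.star_mul _ _
  | star_plus a =>
    obtain ⟨c, hc⟩ := hr.symm ▸ Set.mem_range_self (f := LeftEhresmannMonoid.plus) (eval g a)
    have := hq.star_mul c 1
    simp only [_root_.mul_one] at this
    simp only [eval]
    rw [← hc, ← this]
  | plus_star a =>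
    obtain ⟨c, hc⟩ := hr ▸ Set.mem_range_self (f := EhresmannMonoid.star) (eval g a)
    have := hp.plus_mul 1 c
    simp only [_root_.one_mul] at this
    simp only [eval]
    rw [← hc, ← this]

/-- The universal property: `FAd X` is the free Ehresmann monoid on `X`. -/
theorem existsUnique_lift {S : Type v} [EhresmannMonoid S] (g : X → S) :
    ∃! f : FAd X →* S,
      (∀ a, f (LeftEhresmannMonoid.plus a) = LeftEhresmannMonoid.plus (f a)) ∧
      (∀ a, f (EhresmannMonoid.star a) = EhresmannMonoid.star (f a)) ∧
      ∀ x, f (of x) = g x := by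
  refine ⟨{ toFun := Quotient.lift (eval g) fun _ _ h => eval_eq g h
            map_one' := rfl
            map_mul' := ?_ }, ⟨?_, ?_, fun _ => rfl⟩, ?_⟩
  · rintro ⟨a⟩ ⟨b⟩
    rfl
  · rintro ⟨a⟩
    rfl
  · rintro ⟨a⟩
    rfl
  · rintro f ⟨hp, hq, hx⟩
    ext t
    obtain ⟨t, rfl⟩ := Quotient.exists_rep t
    induction t with
    | var x => exact hx x
    | one => exact f.map_one
    | mul a b iha ihb => exact (f.map_mul _ _).trans (congrArg₂ (· * ·) iha ihb)
    | plus a ih => exact (hp _).trans (congrArg LeftEhresmannMonoid.plus ih)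
    | star a ih => exact (hq _).trans (congrArg EhresmannMonoid.star ih)

end FAd

/-! Fix distinct generators `x`, `y` of the free algebra `S`, and let `w` generate the cyclic act
with the single defining relation `w = x w`. The elements `s w` and `t w` agree exactly when `s x^k
= t x^l` for some `k`, `l`. In the subact generated by `y w`, a relation `s y w = t y w` therefore
means `s y x^k = t y x^l`. Here `k = l` is forced, so the annihilator congruence of `y w` is the
union over `k` of the ascending chain of left congruences `{(s, t) | s y x^k = t y x^k}`. If the
subact were finitely presented, the chain would become stationary. It does not: `(y x^(k+1))⁺` fixes
`y x^(k+1)` but not `y x^k`.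

`not_isLeftCoherent_of_pow` isolates this argument. Its hypotheses on `S` are checked by mapping `S`
to concrete models, so no normal form for free Ehresmann monoids is needed: self-maps of ℕ recover
`k` from `u y x^k`, and binary relations on ℕ show that the chain is strict. Right coherence of `FAd
X` is handled dually, with `*` in place of `⁺`. -/

open Filter

/-! ### A criterion for non-coherence -/

/-- If `B = S z` is finitely presented and every relation `s z = t z` eventually holds for the
elements `w n` of an act, then from some `n` on all these relations hold for `w n`. -/
theorem IsFinitelyPresentedAct.eventually_forall_smul_eq {S : Type u} [Monoid S] {B C : Type*}
    [MulAction S B] [MulAction S C] (hB : IsFinitelyPresentedAct S B) (z : B)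
    (hz : ∀ b : B, ∃ s : S, s • z = b) (w : ℕ → C)
    (h : ∀ s t : S, s • z = t • z → ∀ᶠ n in atTop, s • w n = t • w n) :
    ∀ᶠ n in atTop, ∀ s t : S, s • z = t • z → s • w n = t • w n := by
  obtain ⟨m, ρ, ⟨Y, hYfin, hYρ, hYmin⟩, f, hf⟩ := hB
  let mk : FreeAct S (Fin m) → ρ.Quotient := fun a => Quotient.mk ρ.toSetoid a
  -- The free generators map to multiples `t i • z`. Replacing `z` by `w n` turns the presentation
  -- of `B` into a map from the free act to `C`.
  choose t ht using fun i : Fin m => hz (f (mk ⟨i, 1⟩))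
  have hmk : ∀ a, f (mk a) = (a.2 * t a.1) • z := by
    rintro ⟨i, s⟩
    have : mk ⟨i, s⟩ = s • mk ⟨i, 1⟩ := by
      change mk ⟨i, s⟩ = mk ⟨i, s • 1⟩
      simp
    rw [this, map_smul, ← ht i, mul_smul]
  obtain ⟨a₀, ha₀⟩ : ∃ a, f (mk a) = z := by
    obtain ⟨q, hq⟩ := hf.2 z
    obtain ⟨a, rfl⟩ := Quotient.exists_rep q
    exact ⟨a, hq⟩
  have hgen : ∀ᶠ n in atTop, ∀ p ∈ Y, (p.1.2 * t p.1.1) • w n = (p.2.2 * t p.2.1) • w n := by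
    refine (eventually_all_finite hYfin).2 fun p hp => h _ _ ?_
    rw [← hmk, ← hmk]
    exact congrArg f (Quotient.sound (hYρ p hp))
  -- The word that expresses `z` through the generators must also return `w n` to itself. This is
  -- one more relation of `z`, beyond the finitely many from `Y`.
  have hbase : ∀ᶠ n in atTop, (a₀.2 * t a₀.1) • w n = (1 : S) • w n :=
    h _ _ (by rw [← hmk, ha₀, one_smul])
  filter_upwards [hgen, hbase] with n hn hn₀ s r hsr
  -- The kernel of `(i, s) ↦ (s * t i) • w n`. It contains `Y` for this `n`, hence contains `ρ`.
  let σ : SMulCon S (FreeAct S (Fin m)) :=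
    { r := fun a b => (a.2 * t a.1) • w n = (b.2 * t b.1) • w n
      iseqv := ⟨fun _ => rfl, fun h => h.symm, fun h h' => h.trans h'⟩
      smul := by
        intro c a b hab
        change (c * a.2 * t a.1) • w n = (c * b.2 * t b.1) • w n
        rw [mul_assoc, mul_smul, hab, ← mul_smul, mul_assoc] }
  have hρ : mk (s • a₀) = mk (r • a₀) := by
    apply hf.1
    change f (s • mk a₀) = f (r • mk a₀)
    rw [map_smul, map_smul, ha₀, hsr]
  have key : (s * a₀.2 * t a₀.1) • w n = (r * a₀.2 * t a₀.1) • w n :=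
    hYmin σ hn _ _ (Quotient.exact hρ)
  rw [one_smul] at hn₀
  rwa [mul_assoc, mul_smul, hn₀, mul_assoc, mul_smul, hn₀] at key

/-- The congruence on the free cyclic act that identifies `s` and `s * x`. -/
def powCon {S : Type u} [Monoid S] (x : S) : SMulCon S (FreeAct S (Fin 1)) where
  r a b := ∃ k l : ℕ, a.2 * x ^ k = b.2 * x ^ l
  iseqv := by
    refine ⟨fun a => ⟨0, 0, rfl⟩, fun ⟨k, l, h⟩ => ⟨l, k, h.symm⟩, ?_⟩
    rintro a b c ⟨k, l, h⟩ ⟨k', l', h'⟩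
    refine ⟨k + k', l' + l, ?_⟩
    rw [pow_add, ← mul_assoc, h, mul_assoc, ← pow_add, add_comm, pow_add, ← mul_assoc, h',
      mul_assoc, ← pow_add]
  smul := by
    rintro s a b ⟨k, l, h⟩
    refine ⟨k, l, ?_⟩
    change s * a.2 * x ^ k = s * b.2 * x ^ l
    rw [mul_assoc, h, mul_assoc]

theorem powCon_isFinitelyGenerated {S : Type u} [Monoid S] (x : S) :
    (powCon x).IsFinitelyGenerated := by
  refine ⟨{(⟨0, 1⟩, ⟨0, x⟩)}, Set.finite_singleton _, ?_, ?_⟩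
  · rintro _ rfl
    exact ⟨1, 0, by simp⟩
  · intro σ hσ
    have hx : σ.toSetoid ⟨0, 1⟩ ⟨0, x⟩ := hσ _ rfl
    have hpow : ∀ (s : S) (k : ℕ), σ.toSetoid ⟨0, s⟩ ⟨0, s * x ^ k⟩ := by
      intro s k
      induction k with
      | zero => simp
      | succ k ih =>
        -- The generating pair multiplied by `s * x ^ k` gives the next power.
        refine σ.toSetoid.trans ih ?_
        have : σ.toSetoid ⟨0, s * x ^ k * 1⟩ ⟨0, s * x ^ k * x⟩ := σ.smul (s * x ^ k) hx
        rwa [mul_one, mul_assoc, ← pow_succ] at this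
    rintro ⟨i, a⟩ ⟨j, b⟩ ⟨k, l, h⟩
    obtain rfl := Subsingleton.elim i 0
    obtain rfl := Subsingleton.elim j 0
    refine σ.toSetoid.trans (hpow a k) ?_
    have h' : a * x ^ k = b * x ^ l := h
    rw [h']
    exact σ.toSetoid.symm (hpow b l)

/-- If the left annihilators of the elements `y * x ^ k` form a chain that does not become
stationary, and `y * x ^ k`, `y * x ^ l` have no common left multiple for `k ≠ l`, then the monoid
is not left coherent: the subact generated by `y` in the act `⟨w | w = x w⟩` is not finitely
presented. -/
theorem not_isLeftCoherent_of_pow {S : Type u} [Monoid S] (x y : S) (e : ℕ → S)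
    (hlen : ∀ (u v : S) (k l : ℕ), u * (y * x ^ k) = v * (y * x ^ l) → k = l)
    (he : ∀ k, e k * (y * x ^ k) = y * x ^ k)
    (hne : ∀ k, e (k + 1) * (y * x ^ k) ≠ y * x ^ k) : ¬ IsLeftCoherent S := by
  intro hS
  let mk : S → (powCon x).Quotient := fun s => Quotient.mk (powCon x).toSetoid ⟨0, s⟩
  have hmk : ∀ s t : S, mk s = mk t ↔ ∃ k l : ℕ, s * x ^ k = t * x ^ l := fun s t => Quotient.eq
  let B : SubMulAction S (powCon x).Quotient :=
    { carrier := {a | ∃ s : S, a = s • mk y}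
      smul_mem' := by
        rintro c _ ⟨s, rfl⟩
        exact ⟨c * s, (mul_smul _ _ _).symm⟩ }
  have hB : IsFinitelyPresentedAct S B := by
    refine hS _ ⟨1, powCon x, powCon_isFinitelyGenerated x, MulActionHom.id S,
      Function.bijective_id⟩ B ⟨{mk y}, Set.finite_singleton _, ?_⟩
    ext a
    simp only [Set.mem_singleton_iff, exists_eq_left]
    rfl
  let z : B := ⟨mk y, 1, (one_smul _ _).symm⟩
  have hz : ∀ s t : S, s • z = t • z ↔ mk (s * y) = mk (t * y) := fun s t => Subtype.ext_iff
  obtain ⟨n, hn⟩ := (hB.eventually_forall_smul_eq z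
    (by
      rintro ⟨_, s, rfl⟩
      exact ⟨s, rfl⟩)
    (fun n => y * x ^ n)
    (by
      intro s t hst
      obtain ⟨k, l, h⟩ := (hmk _ _).1 ((hz s t).1 hst)
      rw [mul_assoc, mul_assoc] at h
      -- Equal exponents let the relation be multiplied on the right by any further power of `x`, so
      -- it persists for all `n ≥ k`.
      obtain rfl := hlen _ _ _ _ h
      filter_upwards [eventually_ge_atTop k] with n hkn
      obtain ⟨d, rfl⟩ := Nat.exists_eq_add_of_le hkn
      simp only [smul_eq_mul, pow_add, ← mul_assoc] at h ⊢
      rw [h])).exists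
  -- `e (n + 1)` fixes `y * x ^ (n + 1)`, hence fixes `z`. By the choice of `n` it would then fix `y
  -- * x ^ n` too.
  apply hne n
  have := hn (e (n + 1)) 1 ((hz _ _).2 ((hmk _ _).2 ⟨n + 1, n + 1, by
    rw [mul_assoc, he, one_mul]⟩))
  simpa using this

/-! ### Models of the identities of Ehresmann monoids -/

/-- An Ehresmann monoid from its defining identities. -/
abbrev EhresmannMonoid.ofIdentities {S : Type u} [Monoid S] (p q : S → S)
    (hp : LeftEhresmannIdentities p) (hq : RightEhresmannIdentities q)
    (hr : Set.range q = Set.range p) : EhresmannMonoid S where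
  plus := p
  isLeftEhresmann := ((leftEhresmann_iff_identities p).2 hp).1
  tildeR_plus := ((leftEhresmann_iff_identities p).2 hp).2
  star := q
  range_star := hr
  isRightEhresmann := ((rightEhresmann_iff_identities q).2 hq).1
  tildeL_star := ((rightEhresmann_iff_identities q).2 hq).2

/-- Every monoid is an Ehresmann monoid with respect to the trivial semilattice. -/
abbrev EhresmannMonoid.trivial (S : Type u) [Monoid S] : EhresmannMonoid S :=
  .ofIdentities (fun _ => 1) (fun _ => 1)
    ⟨by simp, by simp, by simp, by simp⟩ ⟨by simp, by simp, by simp, by simp⟩ rfl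

/-- The binary relations on `α`. -/
def BinRel (α : Type u) : Type u := α → α → Prop

/-! ### The Ehresmann monoid of binary relations -/

namespace BinRel

variable {α : Type u}

@[ext]
theorem ext {a b : BinRel α} (h : ∀ i j, a i j ↔ b i j) : a = b :=
  funext fun i => funext fun j => propext (h i j)

/-- Binary relations form a monoid under composition from left to right. -/
instance : Monoid (BinRel α) where
  one := fun i j => i = j
  mul a b := fun i j => ∃ k, a i k ∧ b k j
  mul_assoc a b c := ext fun i j =>
    ⟨fun ⟨k, ⟨l, h₁, h₂⟩, h₃⟩ => ⟨l, h₁, k, h₂, h₃⟩, fun ⟨l, h₁, k, h₂, h₃⟩ => ⟨k, ⟨l, h₁, h₂⟩, h₃⟩⟩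
  one_mul a := ext fun i j => ⟨fun ⟨_, h, h'⟩ => h ▸ h', fun h => ⟨i, rfl, h⟩⟩
  mul_one a := ext fun i j => ⟨fun ⟨_, h, h'⟩ => h' ▸ h, fun h => ⟨j, h, rfl⟩⟩

theorem one_apply (i j : α) : (1 : BinRel α) i j ↔ i = j := Iff.rfl

theorem mul_apply (a b : BinRel α) (i j : α) : (a * b) i j ↔ ∃ k, a i k ∧ b k j := Iff.rfl

/-- The identity relation on the domain. -/
def dom (a : BinRel α) : BinRel α := fun i j => i = j ∧ ∃ k, a i k

/-- The identity relation on the range. -/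
def ran (a : BinRel α) : BinRel α := fun i j => i = j ∧ ∃ k, a k i

theorem dom_apply (a : BinRel α) (i j : α) : dom a i j ↔ i = j ∧ ∃ k, a i k := Iff.rfl

theorem ran_apply (a : BinRel α) (i j : α) : ran a i j ↔ i = j ∧ ∃ k, a k i := Iff.rfl

instance : EhresmannMonoid (BinRel α) :=
  .ofIdentities dom ran
    ⟨fun a => by ext; simp only [mul_apply, dom_apply]; grind,
      fun a b => by ext; simp only [mul_apply, dom_apply]; grind,
      fun a b => by ext; simp only [mul_apply, dom_apply]; grind,
      fun a b => by ext; simp only [mul_apply, dom_apply]; grind⟩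
    ⟨fun a => by ext; simp only [mul_apply, ran_apply]; grind,
      fun a b => by ext; simp only [mul_apply, ran_apply]; grind,
      fun a b => by ext; simp only [mul_apply, ran_apply]; grind,
      fun a b => by ext; simp only [mul_apply, ran_apply]; grind⟩
    (by
      apply Set.Subset.antisymm
      · rintro _ ⟨a, rfl⟩
        exact ⟨ran a, by ext; simp only [dom_apply, ran_apply]; grind⟩
      · rintro _ ⟨a, rfl⟩
        exact ⟨dom a, by ext; simp only [dom_apply, ran_apply]; grind⟩)

/-- The relation `{(n + 1, n)}` on the natural numbers. -/
def pred : BinRel ℕ := fun i j => i = j + 1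

/-- The relation `{(n, n + 1)}` on the natural numbers. -/
def succ : BinRel ℕ := fun i j => j = i + 1

theorem pred_pow_apply (k i j : ℕ) : (pred ^ k) i j ↔ i = j + k := by
  induction k generalizing j with
  | zero => simp [one_apply]
  | succ k ih =>
    rw [pow_succ, mul_apply]
    simp only [ih, pred]
    grind

theorem succ_pow_apply (k i j : ℕ) : (succ ^ k) i j ↔ j = i + k := by
  induction k generalizing j with
  | zero => simp [one_apply, eq_comm]
  | succ k ih =>
    rw [pow_succ, mul_apply]
    simp only [ih, succ]
    grind

/-- The pair `(k, 0)` lies in `pred ^ k`, but the domain of `pred ^ (k + 1)` starts at `k + 1`. -/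
theorem dom_pred_pow_mul_ne (k : ℕ) : dom (pred ^ (k + 1)) * pred ^ k ≠ pred ^ k := by
  intro h
  have h₀ : (pred ^ k) k 0 := by simp [pred_pow_apply]
  rw [← h] at h₀
  simp only [mul_apply, dom_apply, pred_pow_apply] at h₀
  grind

/-- The pair `(0, k)` lies in `succ ^ k`, but the range of `succ ^ (k + 1)` starts at `k + 1`. -/
theorem succ_pow_mul_ran_ne (k : ℕ) : succ ^ k * ran (succ ^ (k + 1)) ≠ succ ^ k := by
  intro h
  have h₀ : (succ ^ k) 0 k := by simp [succ_pow_apply]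
  rw [← h] at h₀
  simp only [mul_apply, ran_apply, succ_pow_apply] at h₀
  grind

end BinRel

/-! ### Self-maps of ℕ that count powers -/

namespace Function.End

/-- The successor map as an element of the monoid of self-maps. -/
def natSucc : Function.End ℕ := Nat.succ

/-- The zero map as an element of the monoid of self-maps. -/
def natZero : Function.End ℕ := fun _ => 0

/-- `natZero` erases whatever `u` did, and only the `k` successor steps after it remain visible. -/
theorem natSucc_pow_mul_natZero_mul_apply (k n : ℕ) (u : Function.End ℕ) :
    (natSucc ^ k * natZero * u) n = k := by
  induction k with
  | zero => rfl
  | succ k ih =>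
    rw [pow_succ', mul_assoc, mul_assoc, ← mul_assoc (natSucc ^ k)]
    exact congrArg Nat.succ ih

theorem natSucc_pow_mul_natZero_mul_inj {k l : ℕ} {u v : Function.End ℕ}
    (h : natSucc ^ k * natZero * u = natSucc ^ l * natZero * v) : k = l := by
  rw [← natSucc_pow_mul_natZero_mul_apply k 0 u, h, natSucc_pow_mul_natZero_mul_apply]

end Function.End

/-! ### The free algebras are not coherent -/

namespace FLAd

variable {X : Type u}

/-- A map from `X` to a monoid extends to a monoid homomorphism on `FLAd X`. -/
theorem exists_monoidHom {M : Type v} [Monoid M] (g : X → M) :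
    ∃ f : FLAd X →* M, ∀ x, f (of x) = g x := by
  -- With the trivial semilattice `⁺` is constantly 1, so it puts no constraint on the images of the
  -- generators.
  let _ := EhresmannMonoid.trivial M
  obtain ⟨f, ⟨-, hf⟩, -⟩ := existsUnique_lift g
  exact ⟨f, hf⟩

theorem not_isLeftCoherent [Nontrivial X] : ¬ IsLeftCoherent (FLAd X) := by
  classical
  obtain ⟨x, y, hxy⟩ := exists_pair_ne X
  refine not_isLeftCoherent_of_pow (of x) (of y) (fun k => plus (of y * of x ^ k)) ?_
    (fun k => identities.plus_mul_self _) ?_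
  · intro u v k l h
    -- In the opposite monoid of self-maps the left factor acts first: `u` acts, `y` resets to 0,
    -- and `x ^ k` counts up to `k`.
    obtain ⟨f, hf⟩ := exists_monoidHom (M := (Function.End ℕ)ᵐᵒᵖ)
      fun t : X => if t = y then .op Function.End.natZero else .op Function.End.natSucc
    have := congrArg (fun a => (f a).unop) h
    simp only [map_mul, map_pow, hf, if_neg hxy, if_true, MulOpposite.unop_mul,
      MulOpposite.unop_pow, MulOpposite.unop_op] at this
    exact Function.End.natSucc_pow_mul_natZero_mul_inj this
  · intro k h
    -- Sending `y` to 1 reduces the claim to powers of the image of `x`.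
    obtain ⟨f, ⟨hp, hf⟩, -⟩ := existsUnique_lift
      fun t : X => if t = y then 1 else BinRel.pred
    have hplus : ∀ a, f (plus a) = BinRel.dom (f a) := hp
    have := congrArg f h
    simp only [map_mul, map_pow, hplus, hf, if_neg hxy, if_true, one_mul] at this
    exact BinRel.dom_pred_pow_mul_ne k this

end FLAd

namespace FAd

variable {X : Type u}

/-- A map from `X` to a monoid extends to a monoid homomorphism on `FAd X`. -/
theorem exists_monoidHom {M : Type v} [Monoid M] (g : X → M) :
    ∃ f : FAd X →* M, ∀ x, f (of x) = g x := by
  let _ := EhresmannMonoid.trivial M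
  obtain ⟨f, ⟨-, -, hf⟩, -⟩ := existsUnique_lift g
  exact ⟨f, hf⟩

theorem not_isLeftCoherent [Nontrivial X] : ¬ IsLeftCoherent (FAd X) := by
  classical
  obtain ⟨x, y, hxy⟩ := exists_pair_ne X
  refine not_isLeftCoherent_of_pow (of x) (of y) (fun k => plus (of y * of x ^ k)) ?_
    (fun k => plus_identities.plus_mul_self _) ?_
  · intro u v k l h
    obtain ⟨f, hf⟩ := exists_monoidHom (M := (Function.End ℕ)ᵐᵒᵖ)
      fun t : X => if t = y then .op Function.End.natZero else .op Function.End.natSucc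
    have := congrArg (fun a => (f a).unop) h
    simp only [map_mul, map_pow, hf, if_neg hxy, if_true, MulOpposite.unop_mul,
      MulOpposite.unop_pow, MulOpposite.unop_op] at this
    exact Function.End.natSucc_pow_mul_natZero_mul_inj this
  · intro k h
    obtain ⟨f, ⟨hp, -, hf⟩, -⟩ := existsUnique_lift
      fun t : X => if t = y then 1 else BinRel.pred
    have hplus : ∀ a, f (plus a) = BinRel.dom (f a) := hp
    have := congrArg f h
    simp only [map_mul, map_pow, hplus, hf, if_neg hxy, if_true, one_mul] at this
    exact BinRel.dom_pred_pow_mul_ne k this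

theorem not_isRightCoherent [Nontrivial X] : ¬ IsRightCoherent (FAd X) := by
  classical
  obtain ⟨x, y, hxy⟩ := exists_pair_ne X
  -- In the opposite monoid `y * x ^ k` reads as `x ^ k * y`, whose right identity `(x ^ k * y)*`
  -- acts as a left identity.
  refine not_isLeftCoherent_of_pow (.op (of x)) (.op (of y))
    (fun k => .op (star (of x ^ k * of y))) ?_
    (fun k => congrArg MulOpposite.op (star_identities.self_mul_star _)) ?_
  · intro u v k l h
    -- The words are now `x ^ k * y * u`, and composition already applies `u` first, so no opposite
    -- is needed.
    obtain ⟨f, hf⟩ := exists_monoidHom (M := Function.End ℕ)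
      fun t : X => if t = y then Function.End.natZero else Function.End.natSucc
    have := congrArg (fun a => f a.unop) h
    simp only [MulOpposite.unop_mul, MulOpposite.unop_pow, MulOpposite.unop_op, map_mul, map_pow,
      hf, if_neg hxy, if_true] at this
    exact Function.End.natSucc_pow_mul_natZero_mul_inj this
  · intro k h
    obtain ⟨f, ⟨-, hq, hf⟩, -⟩ := existsUnique_lift
      fun t : X => if t = y then 1 else BinRel.succ
    have hstar : ∀ a, f (star a) = BinRel.ran (f a) := hq
    have := congrArg (fun a => f a.unop) h
    simp only [MulOpposite.unop_mul, MulOpposite.unop_pow, MulOpposite.unop_op, map_mul, map_pow,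
      hstar, hf, if_neg hxy, if_true, mul_one] at this
    exact BinRel.succ_pow_mul_ran_ne k this

end FAd

theorem theorem5p1 (X : Type u) [Nontrivial X] :
    ¬ IsLeftCoherent (FAd X) ∧ ¬ IsRightCoherent (FAd X) ∧ ¬ IsLeftCoherent (FLAd X) :=
  ⟨FAd.not_isLeftCoherent, FAd.not_isRightCoherent, FLAd.not_isLeftCoherent⟩
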